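/- A \emph{generalised hexagon} is a nonempty point-line geometry $\Gamma=(\mathcal P,\mathcal L)$ containing no ordinary $2$-, $3$-, $4$- or $5$-gon as a subgeometry and such that any two elements of $\mathcal P\cup\mathcal L$ are contained in an ordinary hexagon; it is \emph{thick} if every line contains at least $3$ points and every point is on at least $3$ lines. Let $d$ be the distance in the incidence graph, write $\Gamma_i(x)$ for the set of elements at distance $i$ from $x$, and call $x,y$ \emph{opposite} if $d(x,y)=6$. A \emph{Moufang hexagon} is a thick generalised hexagon such that for every path $(x_0,x_1,\dots,x_6)$ in the incidence graph with $x_{i-1}\neq x_{i+1}$ for $1\le i\le 5$, the group of collineations fixing every element incident with at least one of $x_1,\dots,x_5$ acts transitively on $\Gamma_1(x_6)\setminus\{x_5\}$. A point $x$ is \emph{regular} if, for $i=2$ and for $i=3$ and for all $y,y'$ opposite $x$, the sets $\Gamma_i(x)\cap\Gamma_{6-i}(y)$ and $\Gamma_i(x)\cap\Gamma_{6-i}(y')$ are either equal or have at most one element in common. An \emph{ovoid} is a set $O$ of mutually opposite points such that every element of $\mathcal P\cup\mathcal L$ is at distance at most $3$ from some element of $O$. \textbf{Theorem.} Let $\Gamma$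 be a Moufang hexagon all of whose points are regular. Then no nontrivial collineation of $\Gamma$ fixes an ovoid of $\Gamma$ pointwise; that is, if $\theta$ is a collineation of $\Gamma$ and $O$ is an ovoid of $\Gamma$ with $p^\theta=p$ for all $p\in O$, then $\theta$ is the identity. -/

import Mathlib

/-! Point-line geometries are given by a type `P` of points, a type `L` of lines and an incidence
relation `I : P → L → Prop`; the elements of the geometry are the members of `P ⊕ L`. -/

namespace MoufangHexagon

universe u v

variable {P : Type u} {L : Type v}

/-- An ordinary `n`-gon in the geometry: `n` distinct points and `n` distinct lines, cyclically
indexed, such that the `i`-th line is incident with the `i`-th and the `(i+1)`-st point. -/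
structure OrdinaryPolygon (I : P → L → Prop) (n : ℕ) where
  pt : ZMod n → P
  ln : ZMod n → L
  pt_injective : Function.Injective pt
  ln_injective : Function.Injective ln
  inc_left : ∀ i, I (pt i) (ln i)
  inc_right : ∀ i, I (pt (i + 1)) (ln i)

/-- The set of elements (points and lines) of an ordinary `n`-gon. -/
def OrdinaryPolygon.elements {I : P → L → Prop} {n : ℕ} (A : OrdinaryPolygon I n) : Set (P ⊕ L) :=
  Set.range (fun i => Sum.inl (A.pt i)) ∪ Set.range (fun i => Sum.inr (A.ln i))

/-- A generalised hexagon: a nonempty geometry without ordinary `2`-, `3`-, `4`- or `5`-gons in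
which any two elements lie in an ordinary hexagon. -/
structure IsGeneralisedHexagon (I : P → L → Prop) : Prop where
  nonempty : Nonempty (P ⊕ L)
  no_small_polygon : ∀ n : ℕ, 2 ≤ n → n ≤ 5 → IsEmpty (OrdinaryPolygon I n)
  exists_hexagon : ∀ x y : P ⊕ L, ∃ A : OrdinaryPolygon I 6, x ∈ A.elements ∧ y ∈ A.elements

/-- Every line has at least three points, and every point is on at least three lines. -/
def IsThick (I : P → L → Prop) : Prop :=
  (∀ l : L, 3 ≤ {p : P | I p l}.encard) ∧ (∀ p : P, 3 ≤ {l : L | I p l}.encard)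

/-- The incidence graph. -/
def incidenceGraph (I : P → L → Prop) : SimpleGraph (P ⊕ L) where
  Adj
    | Sum.inl p, Sum.inr l => I p l
    | Sum.inr l, Sum.inl p => I p l
    | _, _ => False
  symm := ⟨by rintro (p | l) (q | m) h <;> exact h⟩
  loopless := ⟨by rintro (p | l) h <;> exact h⟩

/-- Distance of two elements in the incidence graph. (The incidence graph of a generalised hexagon
is connected, so this is the true graph distance there.) -/
noncomputable def eltDist (I : P → L → Prop) (x y : P ⊕ L) : ℕ :=
  (incidenceGraph I).dist x y

/-- Two elements are opposite if they are at distance `6`. -/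
def Opposite (I : P → L → Prop) (x y : P ⊕ L) : Prop :=
  eltDist I x y = 6

/-- Collineations: incidence-preserving permutations of the points and of the lines. -/
@[ext]
structure Collineation (I : P → L → Prop) where
  onPoints : P ≃ P
  onLines : L ≃ L
  map_inc : ∀ p l, I (onPoints p) (onLines l) ↔ I p l

/-- The trivial collineation. -/
def Collineation.refl (I : P → L → Prop) : Collineation I where
  onPoints := Equiv.refl P
  onLines := Equiv.refl L
  map_inc := fun _ _ => Iff.rfl

/-- The action of a collineation on the elements. -/
def Collineation.onElements {I : P → L → Prop} (θ : Collineation I) : P ⊕ L → P ⊕ L :=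
  Sum.map θ.onPoints θ.onLines

/-- A root: a non-stammering path `x₀, …, x₆` of length six in the incidence graph. -/
structure IsRoot (I : P → L → Prop) (x : Fin 7 → P ⊕ L) : Prop where
  adj : ∀ i : Fin 6, (incidenceGraph I).Adj (x i.castSucc) (x i.succ)
  ne : ∀ i : Fin 5, x i.castSucc.castSucc ≠ x i.succ.succ

/-- A root elation for `x₀, …, x₆`: a collineation fixing every element incident with at least one
of the interior elements `x₁, …, x₅` (so in particular all of `x₀, …, x₆`). -/
def IsRootElation (I : P → L → Prop) (x : Fin 7 → P ⊕ L) (g : Collineation I) : Prop :=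
  ∀ i : Fin 7, i ≠ 0 → i ≠ 6 → ∀ z : P ⊕ L, (incidenceGraph I).Adj (x i) z → g.onElements z = z

/-- A Moufang hexagon: a thick generalised hexagon such that, for every root `x₀, …, x₆`, the root
elations act transitively on the elements incident with `x₆` and different from `x₅`. -/
structure IsMoufangHexagon (I : P → L → Prop) : Prop where
  isGeneralisedHexagon : IsGeneralisedHexagon I
  isThick : IsThick I
  moufang : ∀ x : Fin 7 → P ⊕ L, IsRoot I x → ∀ y y' : P ⊕ L,
    (incidenceGraph I).Adj (x 6) y → y ≠ x 5 → (incidenceGraph I).Adj (x 6) y' → y' ≠ x 5 →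
      ∃ g : Collineation I, IsRootElation I x g ∧ g.onElements y = y'

/-- The distance-`i`-trace `Γᵢ(x) ∩ Γ₆₋ᵢ(y)`. -/
def trace (I : P → L → Prop) (i : ℕ) (x y : P ⊕ L) : Set (P ⊕ L) :=
  {z | eltDist I x z = i ∧ eltDist I y z = 6 - i}

/-- Distinct distance-`i`-traces of `x` have at most one element in common. -/
def IsDistanceRegular (I : P → L → Prop) (i : ℕ) (x : P ⊕ L) : Prop :=
  ∀ y y' : P ⊕ L, Opposite I x y → Opposite I x y' → trace I i x y ≠ trace I i x y' →
    (trace I i x y ∩ trace I i x y').Subsingleton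

/-- An element is regular if it is distance-`2`-regular and distance-`3`-regular. -/
def IsRegular (I : P → L → Prop) (x : P ⊕ L) : Prop :=
  IsDistanceRegular I 2 x ∧ IsDistanceRegular I 3 x

/-- All points are regular. -/
def IsPointRegular (I : P → L → Prop) : Prop :=
  ∀ p : P, IsRegular I (Sum.inl p)

/-- An ovoid: a set of mutually opposite points such that every element is at distance at most `3`
from some member of the set. -/
structure IsOvoid (I : P → L → Prop) (O : Set P) : Prop where
  opposite : ∀ p ∈ O, ∀ q ∈ O, p ≠ q → Opposite I (Sum.inl p) (Sum.inl q)
  cover : ∀ x : P ⊕ L, ∃ p ∈ O, eltDist I x (Sum.inl p) ≤ 3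

/-- A collineation fixes a set of points if it fixes each of its members. -/
def Collineation.Fixes {I : P → L → Prop} (θ : Collineation I) (O : Set P) : Prop :=
  ∀ p ∈ O, θ.onPoints p = p

end MoufangHexagon

namespace MoufangHexagon

variable {P : Type*} {L : Type*} {I : P → L → Prop}

/-! Everything rests on the trace argument in `line_fixed`. Suppose y ∈ O lies on a line Y that θ
moves. Take z ≠ y on Y, a point p on another line through z, and x ∈ O collinear with p. On a third
line through z there is a point k whose trace at x shares two points with that of y. Take w ∈ O
collinear with k. The traces of x and w at y share z and its image, two points because Y moves, so
they coincide by regularity at y; regularity at x identifies the traces of k and y at x. Projecting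
x onto the line kw then forces y within distance 4 of w, although both lie in O.

Once lines meeting O are fixed, each point moves only along its line to O, and `point_fixed` shows
that any motion would make opposite points collinear.

Distances between points are even, so the relations `Coll`, `Dist4` and `Near` suffice; in
particular, opposite means not `Near`. -/

/-- Two distinct points on a common line. -/
def Coll (I : P → L → Prop) (p q : P) : Prop :=
  p ≠ q ∧ ∃ l, I p l ∧ I q l

/-- Two points at distance at most `4` in the incidence graph. -/
def Near (I : P → L → Prop) (p q : P) : Prop :=
  p = q ∨ Coll I p q ∨ ∃ r, Coll I p r ∧ Coll I r q

/-- Two distinct noncollinear points that are collinear with a common point. -/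
def Dist4 (I : P → L → Prop) (p q : P) : Prop :=
  p ≠ q ∧ ¬ Coll I p q ∧ ∃ r, Coll I p r ∧ Coll I r q

theorem Coll.symm {p q : P} (h : Coll I p q) : Coll I q p :=
  ⟨h.1.symm, h.2.imp fun _ h => ⟨h.2, h.1⟩⟩

theorem Near.symm {p q : P} (h : Near I p q) : Near I q p := by
  rcases h with h | h | ⟨r, h, h'⟩
  · exact .inl h.symm
  · exact .inr (.inl h.symm)
  · exact .inr (.inr ⟨r, h'.symm, h.symm⟩)

theorem Dist4.symm {p q : P} (h : Dist4 I p q) : Dist4 I q p :=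
  ⟨h.1.symm, fun h' => h.2.1 h'.symm, h.2.2.imp fun _ h => ⟨h.2.symm, h.1.symm⟩⟩

theorem Coll.near {p q : P} (h : Coll I p q) : Near I p q := .inr (.inl h)

theorem Coll.near_of_coll {p q r : P} (h : Coll I p r) (h' : Coll I r q) : Near I p q :=
  .inr (.inr ⟨r, h, h'⟩)

theorem Dist4.near {p q : P} (h : Dist4 I p q) : Near I p q := .inr (.inr h.2.2)

/-! ### Absence of small polygons -/

namespace IsGeneralisedHexagon

theorem line_unique (h : IsGeneralisedHexagon I) {a b : P} {l m : L} (hab : a ≠ b)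
    (hal : I a l) (hbl : I b l) (ham : I a m) (hbm : I b m) : l = m := by
  by_contra hlm
  refine (h.no_small_polygon 2 (by norm_num) (by norm_num)).false
    -- `ZMod 2` unfolds to `Fin 2`, so a vector lists the vertices; the larger polygons do the same.
    ⟨(![a, b] : Fin 2 → P), (![l, m] : Fin 2 → L), ?_, ?_, ?_, ?_⟩
  · change Function.Injective (![a, b] : Fin 2 → P)
    intro i j hij
    fin_cases i <;> fin_cases j <;> simp_all
  · change Function.Injective (![l, m] : Fin 2 → L)
    intro i j hij
    fin_cases i <;> fin_cases j <;> simp_all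
  · intro i
    fin_cases i
    · exact hal
    · exact hbm
  · intro i
    fin_cases i
    · exact hbl
    · exact ham

theorem no_triangle (h : IsGeneralisedHexagon I) {a b c : P} {l m n : L}
    (hab : a ≠ b) (hbc : b ≠ c) (hca : c ≠ a) (hlm : l ≠ m) (hmn : m ≠ n) (hnl : n ≠ l)
    (hal : I a l) (hbl : I b l) (hbm : I b m) (hcm : I c m) (hcn : I c n) (han : I a n) :
    False := by
  refine (h.no_small_polygon 3 (by norm_num) (by norm_num)).false
    ⟨(![a, b, c] : Fin 3 → P), (![l, m, n] : Fin 3 → L), ?_, ?_, ?_, ?_⟩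
  · change Function.Injective (![a, b, c] : Fin 3 → P)
    intro i j hij
    fin_cases i <;> fin_cases j <;> simp_all
  · change Function.Injective (![l, m, n] : Fin 3 → L)
    intro i j hij
    fin_cases i <;> fin_cases j <;> simp_all
  · intro i
    fin_cases i
    · exact hal
    · exact hbm
    · exact hcn
  · intro i
    fin_cases i
    · exact hbl
    · exact hcm
    · exact han

/-- Only consecutive vertices and sides need be distinct: any other coincidence would put two
distinct lines through two distinct points. -/
theorem no_quadrangle (h : IsGeneralisedHexagon I) {a b c d : P} {l m n k : L}
    (hab : a ≠ b) (hbc : b ≠ c) (hcd : c ≠ d) (hda : d ≠ a)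
    (hlm : l ≠ m) (hmn : m ≠ n) (hnk : n ≠ k) (hkl : k ≠ l)
    (hal : I a l) (hbl : I b l) (hbm : I b m) (hcm : I c m) (hcn : I c n) (hdn : I d n)
    (hdk : I d k) (hak : I a k) : False := by
  have hac : a ≠ c := by
    rintro rfl; exact hlm (h.line_unique hab hal hbl hcm hbm)
  have hbd : b ≠ d := by
    rintro rfl; exact hmn (h.line_unique hbc hbm hcm hdn hcn)
  have hln : l ≠ n := by
    rintro rfl; exact hlm (h.line_unique hbc hbl hcn hbm hcm)
  have hmk : m ≠ k := by
    rintro rfl; exact hmn (h.line_unique hcd hcm hdk hcn hdn)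
  refine (h.no_small_polygon 4 (by norm_num) (by norm_num)).false
    ⟨(![a, b, c, d] : Fin 4 → P), (![l, m, n, k] : Fin 4 → L), ?_, ?_, ?_, ?_⟩
  · change Function.Injective (![a, b, c, d] : Fin 4 → P)
    intro i j hij
    fin_cases i <;> fin_cases j <;> simp_all
  · change Function.Injective (![l, m, n, k] : Fin 4 → L)
    intro i j hij
    fin_cases i <;> fin_cases j <;> simp_all
  · intro i
    fin_cases i
    · exact hal
    · exact hbm
    · exact hcn
    · exact hdk
  · intro i
    fin_cases i
    · exact hbl
    · exact hcm
    · exact hdn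
    · exact hak

theorem no_pentagon (h : IsGeneralisedHexagon I) {a b c d e : P} {l m n k j : L}
    (hab : a ≠ b) (hbc : b ≠ c) (hcd : c ≠ d) (hde : d ≠ e) (hea : e ≠ a)
    (hlm : l ≠ m) (hmn : m ≠ n) (hnk : n ≠ k) (hkj : k ≠ j) (hjl : j ≠ l)
    (hal : I a l) (hbl : I b l) (hbm : I b m) (hcm : I c m) (hcn : I c n) (hdn : I d n)
    (hdk : I d k) (hek : I e k) (hej : I e j) (haj : I a j) : False := by
  have hac : a ≠ c := by
    rintro rfl; exact hlm (h.line_unique hab hal hbl hcm hbm)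
  have hbd : b ≠ d := by
    rintro rfl; exact hmn (h.line_unique hbc hbm hcm hdn hcn)
  have hce : c ≠ e := by
    rintro rfl; exact hnk (h.line_unique hcd hcn hdn hek hdk)
  have hda : d ≠ a := by
    rintro rfl; exact hkj (h.line_unique hde hdk hek haj hej)
  have heb : e ≠ b := by
    rintro rfl; exact hjl (h.line_unique hea hej haj hbl hal)
  have hln : l ≠ n := by
    rintro rfl; exact hlm (h.line_unique hbc hbl hcn hbm hcm)
  have hmk : m ≠ k := by
    rintro rfl; exact hmn (h.line_unique hcd hcm hdk hcn hdn)
  have hnj : n ≠ j := by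
    rintro rfl; exact hnk (h.line_unique hde hdn hej hdk hek)
  have hkl : k ≠ l := by
    rintro rfl; exact hkj (h.line_unique hea hek hal hej haj)
  have hjm : j ≠ m := by
    rintro rfl; exact hjl (h.line_unique hab haj hbm hal hbl)
  refine (h.no_small_polygon 5 (by norm_num) (by norm_num)).false
    ⟨(![a, b, c, d, e] : Fin 5 → P), (![l, m, n, k, j] : Fin 5 → L), ?_, ?_, ?_, ?_⟩
  · change Function.Injective (![a, b, c, d, e] : Fin 5 → P)
    intro i j hij
    fin_cases i <;> fin_cases j <;> simp_all
  · change Function.Injective (![l, m, n, k, j] : Fin 5 → L)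
    intro i j hij
    fin_cases i <;> fin_cases j <;> simp_all
  · intro i
    fin_cases i
    · exact hal
    · exact hbm
    · exact hcn
    · exact hdk
    · exact hej
  · intro i
    fin_cases i
    · exact hbl
    · exact hcm
    · exact hdn
    · exact hek
    · exact haj

/-! ### Short paths -/

theorem dist4_of_path (h : IsGeneralisedHexagon I) {a b c : P} {l m : L} (hab : a ≠ b)
    (hbc : b ≠ c) (hlm : l ≠ m) (hal : I a l) (hbl : I b l) (hbm : I b m) (hcm : I c m) :
    Dist4 I a c := by
  have hac : a ≠ c := by
    rintro rfl; exact hlm (h.line_unique hab hal hbl hcm hbm)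
  refine ⟨hac, ?_, b, ⟨hab, l, hal, hbl⟩, ⟨hbc, m, hbm, hcm⟩⟩
  rintro ⟨-, n, han, hcn⟩
  refine h.no_triangle hab hbc hac.symm hlm ?_ ?_ hal hbl hbm hcm hcn han
  · rintro rfl; exact hlm (h.line_unique hab hal hbl han hbm)
  · rintro rfl; exact hlm (h.line_unique hbc hbl hcn hbm hcm)

/-- Two midpoints would span a quadrangle with `w` and `c`, or a triangle if two of its sides
coincide. -/
theorem midpoint_unique (h : IsGeneralisedHexagon I) {w a b c : P} (hwc : Dist4 I w c)
    (hwa : Coll I w a) (hac : Coll I a c) (hwb : Coll I w b) (hbc : Coll I b c) : a = b := by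
  by_contra hab
  obtain ⟨nwa, l₁, w1, a1⟩ := hwa
  obtain ⟨nac, l₂, a2, c2⟩ := hac
  obtain ⟨nwb, l₄, w4, b4⟩ := hwb
  obtain ⟨nbc, l₃, b3, c3⟩ := hbc
  have h12 : l₁ ≠ l₂ := by rintro rfl; exact hwc.2.1 ⟨hwc.1, _, w1, c2⟩
  have h34 : l₃ ≠ l₄ := by rintro rfl; exact hwc.2.1 ⟨hwc.1, _, w4, c3⟩
  by_cases h23 : l₂ = l₃
  · subst h23
    exact (h.dist4_of_path nwa hab h12 w1 a1 a2 b3).2.1 ⟨nwb, _, w4, b4⟩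
  by_cases h41 : l₄ = l₁
  · subst h41
    exact (h.dist4_of_path nac.symm hab h12.symm c2 a2 a1 b4).2.1 ⟨nbc.symm, _, c3, b3⟩
  exact h.no_quadrangle nwa nac nbc.symm nwb.symm h12 h23 h34 h41 w1 a1 a2 c2 c3 b3 b4 w4

/-- If no midpoint lies on `m`, the two paths from `w` close up with `m` into a pentagon or
something smaller. -/
theorem exists_coll_on_line (h : IsGeneralisedHexagon I) {w c z : P} {m : L} (hwc : Dist4 I w c)
    (hwz : Dist4 I w z) (hcz : c ≠ z) (hcm : I c m) (hzm : I z m) :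
    ∃ b, I b m ∧ Coll I w b := by
  obtain ⟨nwc, cwc, b₁, ⟨n1, l₁, w1, b1⟩, ⟨n2, l₂, b2, c2⟩⟩ := hwc
  obtain ⟨nwz, cwz, b₂, ⟨n3, l₄, w4, b4⟩, ⟨n4, l₃, b3, z3⟩⟩ := hwz
  by_cases h2m : l₂ = m
  · subst h2m; exact ⟨b₁, b2, n1, _, w1, b1⟩
  by_cases h3m : l₃ = m
  · subst h3m; exact ⟨b₂, b3, n3, _, w4, b4⟩
  have h12 : l₁ ≠ l₂ := by rintro rfl; exact cwc ⟨nwc, _, w1, c2⟩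
  have h34 : l₃ ≠ l₄ := by rintro rfl; exact cwz ⟨nwz, _, w4, z3⟩
  exfalso
  by_cases h41 : l₄ = l₁
  · subst h41
    by_cases hb : b₁ = b₂
    · subst hb
      exact (h.dist4_of_path n2 hcz h2m b2 c2 hcm hzm).2.1 ⟨n4, _, b3, z3⟩
    · exact h.no_quadrangle n2 hcz n4.symm (Ne.symm hb) h2m (Ne.symm h3m) h34 h12
        b2 c2 hcm hzm z3 b3 b4 b1
  · exact h.no_pentagon n1 n2 hcz n4.symm n3.symm h12 h2m (Ne.symm h3m) h34 h41
      w1 b1 b2 c2 hcm hzm z3 b3 b4 w4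

/-- A path of length 6 without backtracking joins opposite points: a shortcut would, by projection
onto `n`, give a second midpoint of `a` and `c`. -/
theorem not_near_of_path (h : IsGeneralisedHexagon I) {a b c d : P} {l m n : L} (hab : a ≠ b)
    (hbc : b ≠ c) (hcd : c ≠ d) (hlm : l ≠ m) (hmn : m ≠ n) (hal : I a l) (hbl : I b l)
    (hbm : I b m) (hcm : I c m) (hcn : I c n) (hdn : I d n) : ¬ Near I a d := by
  have hac := h.dist4_of_path hab hbc hlm hal hbl hbm hcm
  have hn : ∀ e, I e n → ¬ Coll I a e := by
    intro e hen hae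
    have hec : e ≠ c := by rintro rfl; exact hac.2.1 hae
    have := h.midpoint_unique hac ⟨hab, l, hal, hbl⟩ ⟨hbc, m, hbm, hcm⟩ hae ⟨hec, n, hen, hcn⟩
    subst this
    exact hmn (h.line_unique hbc hbm hcm hen hcn)
  intro had
  by_cases had1 : a = d
  · subst had1; exact hac.2.1 ⟨hac.1, n, hdn, hcn⟩
  by_cases had2 : Coll I a d
  · exact hn d hdn had2
  have had4 : Dist4 I a d := ⟨had1, had2, (had.resolve_left had1).resolve_left had2⟩
  obtain ⟨e, hen, hae⟩ := h.exists_coll_on_line hac had4 hcd hcn hdn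
  exact hn e hen hae

theorem exists_near_on_line (h : IsGeneralisedHexagon I) (p : P) (l : L) :
    ∃ q, I q l ∧ Near I p q := by
  obtain ⟨A, hp, hl⟩ := h.exists_hexagon (Sum.inl p) (Sum.inr l)
  obtain ⟨i, rfl⟩ : ∃ i, A.pt i = p := by
    rcases hp with ⟨i, hi⟩ | ⟨i, hi⟩
    · exact ⟨i, Sum.inl_injective hi⟩
    · exact absurd hi Sum.inr_ne_inl
  obtain ⟨j, rfl⟩ : ∃ j, A.ln j = l := by
    rcases hl with ⟨i, hi⟩ | ⟨i, hi⟩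
    · exact absurd hi Sum.inl_ne_inr
    · exact ⟨i, Sum.inr_injective hi⟩
  have step : ∀ i, Coll I (A.pt i) (A.pt (i + 1)) := fun i =>
    ⟨fun e => absurd (A.pt_injective e) (by clear e; revert i; decide), A.ln i, A.inc_left i, A.inc_right i⟩
  obtain ⟨d, rfl⟩ : ∃ d, j = i + d := ⟨j - i, by ring⟩
  have e6 : i + 1 + 1 + 1 + 1 + 1 + 1 = i := by clear hp hl; revert i; decide
  -- The shorter way round the hexagon is forward for offsets 0, 1, 2 and backward, to the right end
  -- of the line, for 3, 4, 5.
  have hd : d = 0 ∨ d = 1 ∨ d = 1 + 1 ∨ d = 1 + 1 + 1 ∨ d = 1 + 1 + 1 + 1 ∨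
      d = 1 + 1 + 1 + 1 + 1 := by clear hl; revert d; decide
  clear hl
  rcases hd with rfl | rfl | rfl | rfl | rfl | rfl <;>
    try simp only [add_zero, ← add_assoc]
  · exact ⟨_, A.inc_left i, .inl rfl⟩
  · exact ⟨_, A.inc_left _, (step i).near⟩
  · exact ⟨_, A.inc_left _, (step i).near_of_coll (step _)⟩
  · refine ⟨_, A.inc_right _,
      Near.symm ((step _).near_of_coll (r := A.pt (i + 1 + 1 + 1 + 1 + 1)) ?_)⟩
    have := step (i + 1 + 1 + 1 + 1 + 1)
    rwa [e6] at this
  · refine ⟨_, A.inc_right _, Coll.near (Coll.symm ?_)⟩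
    have := step (i + 1 + 1 + 1 + 1 + 1)
    rwa [e6] at this
  · exact ⟨_, A.inc_right _, .inl (by rw [e6])⟩

end IsGeneralisedHexagon

/-! ### Distances in the incidence graph -/

/-- The incidence graph is bipartite, so walks between points are consumed two edges at a time; this
supplies all parity arguments. -/
theorem walk_cases {p q : P} (w : (incidenceGraph I).Walk (Sum.inl p) (Sum.inl q)) :
    (p = q ∧ w.length = 0) ∨ ∃ (l : L) (r : P)
      (w' : (incidenceGraph I).Walk (Sum.inl r) (Sum.inl q)),
      I p l ∧ I r l ∧ w'.length + 2 = w.length := by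
  cases w with
  | nil => exact .inl ⟨rfl, rfl⟩
  | @cons _ v _ h w =>
    rcases v with v | l
    · exact h.elim
    cases w with
    | @cons _ r _ h' w =>
      rcases r with r | v
      · exact .inr ⟨l, r, w, h, h', rfl⟩
      · exact h'.elim

theorem eq_or_coll {p q : P} {l : L} (hp : I p l) (hq : I q l) : p = q ∨ Coll I p q :=
  or_iff_not_imp_left.2 fun h => ⟨h, l, hp, hq⟩

theorem exists_walk_of_coll {p q r : P} (h : Coll I p r)
    (w : (incidenceGraph I).Walk (Sum.inl r) (Sum.inl q)) :
    ∃ w' : (incidenceGraph I).Walk (Sum.inl p) (Sum.inl q), w'.length = w.length + 2 := by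
  obtain ⟨-, l, hp, hr⟩ := h
  have h1 : (incidenceGraph I).Adj (Sum.inl p) (Sum.inr l) := hp
  have h2 : (incidenceGraph I).Adj (Sum.inr l) (Sum.inl r) := hr
  exact ⟨.cons h1 (.cons h2 w), rfl⟩

theorem eq_or_coll_of_walk {p q : P} (w : (incidenceGraph I).Walk (Sum.inl p) (Sum.inl q))
    (hw : w.length ≤ 3) : p = q ∨ Coll I p q := by
  obtain ⟨e, -⟩ | ⟨l, r, w', hp, hr, hl⟩ := walk_cases w
  · exact .inl e
  obtain ⟨rfl, -⟩ | ⟨_, _, w'', -, -, hl'⟩ := walk_cases w'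
  · exact eq_or_coll hp hr
  · omega

theorem near_of_walk {p q : P} (w : (incidenceGraph I).Walk (Sum.inl p) (Sum.inl q))
    (hw : w.length ≤ 5) : Near I p q := by
  obtain ⟨e, -⟩ | ⟨l, r, w', hp, hr, hl⟩ := walk_cases w
  · exact .inl e
  obtain rfl | h' := eq_or_coll_of_walk w' (by omega)
  · exact (eq_or_coll hp hr).imp_right .inl
  obtain rfl | h := eq_or_coll hp hr
  · exact h'.near
  · exact h.near_of_coll h'

theorem eltDist_le_four_of_near {p q : P} (h : Near I p q) :
    eltDist I (Sum.inl p) (Sum.inl q) ≤ 4 := by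
  rcases h with rfl | h | ⟨r, h, h'⟩
  · simp [eltDist]
  · obtain ⟨w, hw⟩ := exists_walk_of_coll h .nil
    have := SimpleGraph.dist_le w
    simp only [SimpleGraph.Walk.length_nil] at hw
    unfold eltDist; omega
  · obtain ⟨w, hw⟩ := exists_walk_of_coll h' .nil
    obtain ⟨w', hw'⟩ := exists_walk_of_coll h w
    have := SimpleGraph.dist_le w'
    simp only [SimpleGraph.Walk.length_nil] at hw
    unfold eltDist; omega

theorem not_near_of_opposite {p q : P} (h : Opposite I (Sum.inl p) (Sum.inl q)) :
    ¬ Near I p q := fun h' => by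
  have := eltDist_le_four_of_near h'
  unfold Opposite at h
  omega

namespace IsGeneralisedHexagon

theorem exists_line (h : IsGeneralisedHexagon I) (p : P) : ∃ l, I p l := by
  obtain ⟨A, ⟨i, hi⟩ | ⟨i, hi⟩, -⟩ := h.exists_hexagon (Sum.inl p) (Sum.inl p)
  · exact ⟨A.ln i, by simpa [Sum.inl_injective hi] using A.inc_left i⟩
  · exact absurd hi Sum.inr_ne_inl

theorem exists_walk (h : IsGeneralisedHexagon I) (p q : P) :
    ∃ w : (incidenceGraph I).Walk (Sum.inl p) (Sum.inl q), w.length ≤ 6 := by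
  have extend : ∀ {r : P} (w : (incidenceGraph I).Walk (Sum.inl r) (Sum.inl q)) {p : P},
      p = r ∨ Coll I p r →
      ∃ w' : (incidenceGraph I).Walk (Sum.inl p) (Sum.inl q), w'.length ≤ w.length + 2 := by
    rintro r w p (rfl | hpr)
    · exact ⟨w, by omega⟩
    · exact (exists_walk_of_coll hpr w).imp fun _ hw => hw.le
  obtain ⟨l, hql⟩ := h.exists_line q
  obtain ⟨r, hrl, hpr⟩ := h.exists_near_on_line p l
  obtain ⟨w₁, h₁⟩ := extend .nil (eq_or_coll hrl hql)
  simp only [SimpleGraph.Walk.length_nil] at h₁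
  rcases hpr with rfl | hpr | ⟨s, hps, hsr⟩
  · exact ⟨w₁, by omega⟩
  · obtain ⟨w₂, h₂⟩ := extend w₁ (.inr hpr)
    exact ⟨w₂, by omega⟩
  · obtain ⟨w₂, h₂⟩ := extend w₁ (.inr hsr)
    obtain ⟨w₃, h₃⟩ := extend w₂ (.inr hps)
    exact ⟨w₃, by omega⟩

/-- Reachability matters because `SimpleGraph.dist` takes the default value 0 on disconnected pairs.
-/
theorem exists_walk_eltDist (h : IsGeneralisedHexagon I) (p q : P) :
    ∃ w : (incidenceGraph I).Walk (Sum.inl p) (Sum.inl q),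
      w.length = eltDist I (Sum.inl p) (Sum.inl q) :=
  (h.exists_walk p q).choose.reachable.exists_walk_length_eq_dist

theorem opposite_iff (h : IsGeneralisedHexagon I) {p q : P} :
    Opposite I (Sum.inl p) (Sum.inl q) ↔ ¬ Near I p q := by
  refine ⟨not_near_of_opposite, fun hn => ?_⟩
  obtain ⟨w, hw⟩ := h.exists_walk p q
  obtain ⟨w', hw'⟩ := h.exists_walk_eltDist p q
  have h1 : eltDist I (Sum.inl p) (Sum.inl q) ≤ 6 := (SimpleGraph.dist_le w).trans hw
  have h2 : ¬ w'.length ≤ 5 := fun h5 => hn (near_of_walk w' h5)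
  unfold Opposite
  omega

theorem eltDist_le_three_iff (h : IsGeneralisedHexagon I) {p q : P} :
    eltDist I (Sum.inl p) (Sum.inl q) ≤ 3 ↔ p = q ∨ Coll I p q := by
  constructor
  · intro hd
    obtain ⟨w, hw⟩ := h.exists_walk_eltDist p q
    exact eq_or_coll_of_walk w (by omega)
  · rintro (rfl | hc)
    · simp [eltDist]
    · obtain ⟨w, hw⟩ := exists_walk_of_coll hc .nil
      have := SimpleGraph.dist_le w
      simp only [SimpleGraph.Walk.length_nil] at hw
      unfold eltDist; omega

theorem eltDist_eq_two_iff (h : IsGeneralisedHexagon I) {p q : P} :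
    eltDist I (Sum.inl p) (Sum.inl q) = 2 ↔ Coll I p q := by
  constructor
  · intro hd
    rcases h.eltDist_le_three_iff.1 (hd.trans_le (by norm_num)) with rfl | hc
    · simp [eltDist] at hd
    · exact hc
  · intro hc
    obtain ⟨w, hw⟩ := exists_walk_of_coll hc .nil
    have h1 : eltDist I (Sum.inl p) (Sum.inl q) ≤ w.length := SimpleGraph.dist_le w
    simp only [SimpleGraph.Walk.length_nil] at hw
    obtain ⟨w', hw'⟩ := h.exists_walk_eltDist p q
    obtain ⟨e, -⟩ | ⟨_, _, w'', -, -, hl⟩ := walk_cases w'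
    · exact absurd e hc.1
    · omega

theorem eltDist_eq_four_iff (h : IsGeneralisedHexagon I) {p q : P} :
    eltDist I (Sum.inl p) (Sum.inl q) = 4 ↔ Dist4 I p q := by
  constructor
  · intro hd
    have hn : ¬ (p = q ∨ Coll I p q) := fun h' => by
      have := h.eltDist_le_three_iff.2 h'
      omega
    obtain ⟨w, hw⟩ := h.exists_walk_eltDist p q
    rw [not_or] at hn
    exact ⟨hn.1, hn.2, ((near_of_walk w (by omega)).resolve_left hn.1).resolve_left hn.2⟩
  · intro hc
    have h1 := eltDist_le_four_of_near hc.near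
    have h2 : ¬ eltDist I (Sum.inl p) (Sum.inl q) ≤ 3 := fun h' =>
      (h.eltDist_le_three_iff.1 h').elim hc.1 hc.2.1
    omega

theorem mem_trace_two_iff (h : IsGeneralisedHexagon I) {x y z : P} :
    Sum.inl z ∈ trace I 2 (Sum.inl x) (Sum.inl y) ↔ Coll I x z ∧ Dist4 I y z :=
  and_congr h.eltDist_eq_two_iff h.eltDist_eq_four_iff

/-- Distance-`2`-traces of a regular point with two common points coincide. -/
theorem dist4_of_regular (h : IsGeneralisedHexagon I) {x y y' a b c : P}
    (hx : IsDistanceRegular I 2 (Sum.inl x)) (hy : ¬ Near I x y) (hy' : ¬ Near I x y')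
    (hab : a ≠ b) (hxa : Coll I x a) (hya : Dist4 I y a) (hya' : Dist4 I y' a)
    (hxb : Coll I x b) (hyb : Dist4 I y b) (hyb' : Dist4 I y' b)
    (hxc : Coll I x c) (hyc : Dist4 I y c) : Dist4 I y' c := by
  have heq : trace I 2 (Sum.inl x) (Sum.inl y) = trace I 2 (Sum.inl x) (Sum.inl y') := by
    by_contra hne
    have hs := hx _ _ (h.opposite_iff.2 hy) (h.opposite_iff.2 hy') hne
    exact hab (Sum.inl_injective (hs
      ⟨h.mem_trace_two_iff.2 ⟨hxa, hya⟩, h.mem_trace_two_iff.2 ⟨hxa, hya'⟩⟩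
      ⟨h.mem_trace_two_iff.2 ⟨hxb, hyb⟩, h.mem_trace_two_iff.2 ⟨hxb, hyb'⟩⟩))
  have hc := h.mem_trace_two_iff.2 ⟨hxc, hyc⟩
  rw [heq] at hc
  exact (h.mem_trace_two_iff.1 hc).2

end IsGeneralisedHexagon

/-! ### Collineations -/

namespace Collineation

theorem coll_map (θ : Collineation I) {p q : P} :
    Coll I (θ.onPoints p) (θ.onPoints q) ↔ Coll I p q := by
  constructor
  · rintro ⟨hn, l, hp, hq⟩
    obtain ⟨l, rfl⟩ := θ.onLines.surjective l
    exact ⟨fun e => hn (e ▸ rfl), l, (θ.map_inc _ _).1 hp, (θ.map_inc _ _).1 hq⟩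
  · rintro ⟨hn, l, hp, hq⟩
    exact ⟨fun e => hn (θ.onPoints.injective e), _, (θ.map_inc _ _).2 hp, (θ.map_inc _ _).2 hq⟩

theorem dist4_map (θ : Collineation I) {p q : P} (h : Dist4 I p q) :
    Dist4 I (θ.onPoints p) (θ.onPoints q) := by
  obtain ⟨hn, hc, r, h1, h2⟩ := h
  exact ⟨fun e => hn (θ.onPoints.injective e), fun h' => hc (θ.coll_map.1 h'),
    _, θ.coll_map.2 h1, θ.coll_map.2 h2⟩

end Collineation

/-! ### Thickness and ovoids -/

theorem encard_pair_le_two {α : Type*} {a b : α} : ({a, b} : Set α).encard ≤ 2 := by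
  refine (Set.encard_insert_le _ _).trans ?_
  rw [Set.encard_singleton]
  exact (one_add_one_eq_two).le

/-- Repeating an argument avoids a single line. -/
theorem IsThick.exists_third_line (h : IsThick I) (p : P) (l m : L) :
    ∃ n, I p n ∧ n ≠ l ∧ n ≠ m := by
  by_contra! hc
  have hsub : {n : L | I p n} ⊆ {l, m} := fun n hn => by
    by_cases hl : n = l
    · exact .inl hl
    · exact .inr (hc n hn hl)
  have := (h.2 p).trans ((Set.encard_le_encard hsub).trans encard_pair_le_two)
  exact absurd this (by decide)

theorem IsThick.exists_third_point (h : IsThick I) (l : L) (p q : P) :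
    ∃ r, I r l ∧ r ≠ p ∧ r ≠ q := by
  by_contra! hc
  have hsub : {r : P | I r l} ⊆ {p, q} := fun n hn => by
    by_cases hl : n = p
    · exact .inl hl
    · exact .inr (hc n hn hl)
  have := (h.1 l).trans ((Set.encard_le_encard hsub).trans encard_pair_le_two)
  exact absurd this (by decide)

namespace IsOvoid

variable {O : Set P}

theorem eq_of_near (hO : IsOvoid I O) {p q : P} (hp : p ∈ O) (hq : q ∈ O)
    (h : Near I p q) : p = q := by
  by_contra hn
  exact not_near_of_opposite (hO.opposite p hp q hq hn) h

theorem exists_eq_or_coll (hO : IsOvoid I O) (h : IsGeneralisedHexagon I) (p : P) :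
    ∃ o ∈ O, p = o ∨ Coll I p o :=
  (hO.cover (Sum.inl p)).imp fun _ ho => ⟨ho.1, h.eltDist_le_three_iff.1 ho.2⟩

/-- A collineation fixing an ovoid pointwise fixes every line that meets the ovoid. -/
theorem line_fixed (hO : IsOvoid I O) (h : IsGeneralisedHexagon I) (ht : IsThick I)
    (hreg : ∀ p : P, IsDistanceRegular I 2 (Sum.inl p)) {θ : Collineation I} (hθ : θ.Fixes O)
    {y : P} (hy : y ∈ O) {Y : L} (hyY : I y Y) : θ.onLines Y = Y := by
  by_contra hYθ
  obtain ⟨z, hzY, hzy, -⟩ := ht.exists_third_point Y y y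
  obtain ⟨M, hzM, hMY, -⟩ := ht.exists_third_line z Y Y
  obtain ⟨K, hzK, hKY, hKM⟩ := ht.exists_third_line z Y M
  obtain ⟨p, hpM, hpz, -⟩ := ht.exists_third_point M z z
  have hyz : Coll I y z := ⟨hzy.symm, Y, hyY, hzY⟩
  -- any ovoid point equal or collinear to `z` is `y`
  have hz : ∀ o ∈ O, z = o ∨ Coll I z o → o = y := by
    rintro o ho (rfl | hzo)
    · exact hO.eq_of_near ho hy hyz.symm.near
    · exact (hO.eq_of_near hy ho (hyz.near_of_coll hzo)).symm
  have hyp : Dist4 I y p := h.dist4_of_path hzy.symm hpz.symm hMY.symm hyY hzY hzM hpM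
  obtain ⟨x, hx, hpx⟩ := hO.exists_eq_or_coll h p
  have hxy : x ≠ y := by
    rintro rfl
    exact hpx.elim hyp.1.symm fun h' => hyp.2.1 h'.symm
  have hpx : Coll I p x := by
    refine hpx.resolve_left ?_
    rintro rfl
    exact hxy (hz p hx (eq_or_coll hzM hpM))
  have hxy' : ¬ Near I x y := fun h' => hxy (hO.eq_of_near hx hy h')
  obtain ⟨npx, N, hpN, hxN⟩ := id hpx
  have hNM : N ≠ M := by
    rintro rfl
    exact hxy (hz x hx (eq_or_coll hzM hxN))
  have hxz : Dist4 I x z := h.dist4_of_path npx.symm hpz hNM hxN hpN hpM hzM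
  -- a second point `p'` of the trace of `y` at `x`
  obtain ⟨N', hxN', hNN', -⟩ := ht.exists_third_line x N N
  obtain ⟨p', hpN', hyp'⟩ := h.exists_near_on_line y N'
  have hxp' : Coll I x p' := by
    refine ⟨?_, N', hxN', hpN'⟩
    rintro rfl
    exact hxy' hyp'.symm
  -- A neighbour of a point opposite `v` is at distance at least 4 from `v`.
  have dist4_of_near : ∀ {u c v : P}, ¬ Near I u v → Coll I u c → Near I v c → Dist4 I v c := by
    intro u c v huv huc hvc
    have h1 : v ≠ c := by rintro rfl; exact huv huc.near
    have h2 : ¬ Coll I v c := fun hc => huv (huc.near_of_coll hc.symm)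
    exact ⟨h1, h2, (hvc.resolve_left h1).resolve_left h2⟩
  have hyp' : Dist4 I y p' := dist4_of_near hxy' hxp' hyp'
  have hpp' : p ≠ p' := by
    rintro rfl
    exact hNN' (h.line_unique hxp'.1 hxN' hpN' hxN hpN)
  -- the point `k` of `K` with the same trace at `x`
  obtain ⟨k, hkK, hpk'⟩ := h.exists_near_on_line p' K
  have hkz : k ≠ z := by
    rintro rfl
    exact h.not_near_of_path hpz.symm npx hxp'.1 hNM.symm hNN'.symm hzM hpM hpN hxN hxN' hpN'
      hpk'.symm
  have hxk : ¬ Near I x k :=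
    h.not_near_of_path npx.symm hpz hkz.symm hNM hKM.symm hxN hpN hpM hzM hzK hkK
  have hkp : Dist4 I k p := h.dist4_of_path hkz hpz.symm hKM hkK hzK hzM hpM
  have hkp' : Dist4 I k p' := dist4_of_near hxk hxp' hpk'.symm
  have hky : Dist4 I k y := h.dist4_of_path hkz hzy hKY hkK hzK hzY hyY
  -- the ovoid point `w` near `k`
  obtain ⟨w, hw, hkw⟩ := hO.exists_eq_or_coll h k
  have hwy : w ≠ y := by
    rintro rfl
    exact hkw.elim hky.1 hky.2.1
  have hkw : Coll I k w := by
    refine hkw.resolve_left ?_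
    rintro rfl
    exact hwy (hz k hw (eq_or_coll hzK hkK))
  have hwx : w ≠ x := by
    rintro rfl
    exact hxk hkw.symm.near
  have hxw' : ¬ Near I x w := fun h' => hwx (hO.eq_of_near hx hw h').symm
  have hyw' : ¬ Near I y w := fun h' => hwy (hO.eq_of_near hy hw h').symm
  obtain ⟨nkw, W, hkW, hwW⟩ := id hkw
  have hWK : W ≠ K := by
    rintro rfl
    exact hwy (hz w hw (eq_or_coll hzK hwW))
  have hwz : Dist4 I w z := h.dist4_of_path nkw.symm hkz hWK hwW hkW hkK hzK
  -- the traces of `x` and `w` at `y` coincide, since they share `z` and its image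
  have hyx' : ¬ Near I y x := fun h' => hxy' h'.symm
  have hzθ : z ≠ θ.onPoints z := by
    intro e
    have h1 := (θ.map_inc z Y).2 hzY
    have h2 := (θ.map_inc y Y).2 hyY
    rw [← e] at h1
    rw [hθ y hy] at h2
    exact hYθ (h.line_unique hzy h1 h2 hzY hyY)
  have hyzθ : Coll I y (θ.onPoints z) := by
    have := θ.coll_map.2 hyz
    rwa [hθ y hy] at this
  have hxzθ : Dist4 I x (θ.onPoints z) := by
    have := θ.dist4_map hxz
    rwa [hθ x hx] at this
  have hwzθ : Dist4 I w (θ.onPoints z) := by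
    have := θ.dist4_map hwz
    rwa [hθ w hw] at this
  have htr : ∀ c, Coll I y c → Dist4 I x c → Dist4 I w c := fun c =>
    h.dist4_of_regular (hreg y) hyx' hyw' hzθ hyz hxz hwz hyzθ hxzθ hwzθ
  have htr' : ∀ c, Coll I x c → Dist4 I k c → Dist4 I y c := fun c =>
    h.dist4_of_regular (hreg x) hxk hxy' hpp' hpx.symm hkp hyp hxp' hkp' hyp'
  -- the projection `k₀` of `x` onto `W` yields too short a circuit
  obtain ⟨k₀, hkW₀, hxk₀⟩ := h.exists_near_on_line x W
  have hkk₀ : Coll I k₀ k := by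
    refine ⟨?_, W, hkW₀, hkW⟩
    rintro rfl
    exact hxk hxk₀
  have hwk₀ : Coll I w k₀ := by
    refine ⟨?_, W, hwW, hkW₀⟩
    rintro rfl
    exact hxw' hxk₀
  obtain rfl | hxk₁ | ⟨c, hxc, hck₀⟩ := hxk₀
  · exact hxk hkk₀.near
  · exact hxk (hxk₁.near_of_coll hkk₀)
  have hyc : Dist4 I y c :=
    htr' c hxc (dist4_of_near hxk hxc (hkk₀.symm.near_of_coll hck₀.symm))
  obtain ⟨-, -, z', hyz', hzc'⟩ := id hyc
  have hxz' : Dist4 I x z' := dist4_of_near hyx' hyz' (hxc.near_of_coll hzc'.symm)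
  have hwz' : Dist4 I w z' := htr z' hyz' hxz'
  have hwc : Dist4 I w c := dist4_of_near hxw' hxc (hwk₀.near_of_coll hck₀.symm)
  obtain ⟨ncz, M', hzM', hcM'⟩ := id hzc'
  obtain ⟨b, hbM', hwb⟩ := h.exists_coll_on_line hwz' hwc ncz hzM' hcM'
  have hbc : Coll I b c := ⟨by rintro rfl; exact hwc.2.1 hwb, M', hbM', hcM'⟩
  -- The projection `b` of `w` onto the line z'c is a midpoint of `w` and `c`, as is `k₀`; hence
  -- `k₀` lies on that line.
  obtain rfl := h.midpoint_unique hwc hwk₀ hck₀.symm hwb hbc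
  have hkz' : Coll I k₀ z' := ⟨by rintro rfl; exact hwz'.2.1 hwb, M', hbM', hzM'⟩
  have hyk₀ : Dist4 I y k₀ :=
    dist4_of_near (fun h' => hyw' h'.symm) hwk₀ (hyz'.near_of_coll hkz'.symm)
  -- Both `k₀` and `k` are at distance 4 from `y`, so `y` has a neighbour on `W`, which contains
  -- `w`.
  obtain ⟨b', hbW', hyb'⟩ := h.exists_coll_on_line hyk₀ hky.symm hkk₀.1 hkW₀ hkW
  obtain rfl | hbw := eq_or_coll hbW' hwW
  · exact hyw' hyb'.near
  · exact hyw' (hyb'.near_of_coll hbw)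

/-- If `r` moves along its line to O, so does a suitable neighbour `s`, or `s` is fixed; either way
the images of `r` and `s` are too far apart to be collinear. -/
theorem point_fixed (hO : IsOvoid I O) (h : IsGeneralisedHexagon I) (ht : IsThick I)
    (hreg : ∀ p : P, IsDistanceRegular I 2 (Sum.inl p)) {θ : Collineation I} (hθ : θ.Fixes O)
    (r : P) : θ.onPoints r = r := by
  -- a line joining a point to its ovoid point is fixed
  have key : ∀ r o : P, o ∈ O → ∀ N, I r N → I o N → I (θ.onPoints r) N := by
    intro r o ho N hrN hoN
    have := (θ.map_inc r N).2 hrN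
    rwa [hO.line_fixed h ht hreg hθ ho hoN] at this
  obtain ⟨o, ho, hro⟩ := hO.exists_eq_or_coll h r
  obtain rfl | ⟨nro, N, hrN, hoN⟩ := hro
  · exact hθ r ho
  by_contra hr
  obtain ⟨M, hrM, hMN, -⟩ := ht.exists_third_line r N N
  obtain ⟨s, hsM, hsr, -⟩ := ht.exists_third_point M r r
  have hos : Dist4 I o s := h.dist4_of_path nro.symm hsr.symm hMN.symm hoN hrN hrM hsM
  have hθrs : Coll I (θ.onPoints r) (θ.onPoints s) := θ.coll_map.2 ⟨hsr.symm, M, hrM, hsM⟩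
  have hrs : Dist4 I (θ.onPoints r) s :=
    h.dist4_of_path hr hsr.symm hMN.symm (key r o ho N hrN hoN) hrN hrM hsM
  obtain ⟨o', ho', hso⟩ := hO.exists_eq_or_coll h s
  obtain rfl | ⟨nso, N', hsN', hoN'⟩ := hso
  · exact hos.1 (hO.eq_of_near ho ho' hos.near)
  by_cases hs : θ.onPoints s = s
  · rw [hs] at hθrs
    exact hrs.2.1 hθrs
  -- The path from the image of `r` through `r` and `s` to the image of `s` has length 6.
  refine h.not_near_of_path hr hsr.symm (Ne.symm hs) hMN.symm ?_ (key r o ho N hrN hoN) hrN hrM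
    hsM hsN' (key s o' ho' N' hsN' hoN') hθrs.near
  rintro rfl
  have hro' : r ≠ o' := by
    rintro rfl
    exact nro (hO.eq_of_near ho ho' (Coll.near ⟨nro.symm, N, hoN, hrN⟩)).symm
  have := hO.eq_of_near ho ho'
    (Coll.near_of_coll ⟨nro.symm, N, hoN, hrN⟩ ⟨hro', M, hrM, hoN'⟩)
  subst this
  exact hMN (h.line_unique nro hrM hoN' hrN hoN)

end IsOvoid

end MoufangHexagon

theorem mainTheorem9 {P : Type*} {L : Type*} (I : P → L → Prop)
    (hM : MoufangHexagon.IsMoufangHexagon I) (hreg : MoufangHexagon.IsPointRegular I) :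
    ¬ ∃ θ : MoufangHexagon.Collineation I,
      θ ≠ MoufangHexagon.Collineation.refl I ∧
        ∃ O : Set P, MoufangHexagon.IsOvoid I O ∧ θ.Fixes O := by
  rintro ⟨θ, hne, O, hO, hθ⟩
  have h := hM.isGeneralisedHexagon
  have hp := hO.point_fixed h hM.isThick (fun p => (hreg p).1) hθ
  refine hne (MoufangHexagon.Collineation.ext (Equiv.ext hp) (Equiv.ext fun l => ?_))
  -- `o` merely supplies a point to avoid.
  obtain ⟨o, -, -⟩ := hO.cover (Sum.inr l)
  obtain ⟨a, ha, -⟩ := hM.isThick.exists_third_point l o o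
  obtain ⟨b, hb, hba, -⟩ := hM.isThick.exists_third_point l a a
  have ha' := (θ.map_inc a l).2 ha
  have hb' := (θ.map_inc b l).2 hb
  rw [hp] at ha' hb'
  exact h.line_unique hba hb' ha' hb ha
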